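/- Let $V$ be a (finite-dimensional, unital) Euclidean Jordan algebra with $\dim V\ge 2$: a finite-dimensional real inner product space with a commutative bilinear product satisfying the Jordan identity, a unit $e$, and $\langle xy,z\rangle=\langle y,xz\rangle$ for all $x,y,z$. Let $Q=\{x^2: x\in V\}$ be its cone of squares and write $x\le_Q y$ for $y-x\in Q$. A face of $Q$ is a convex subcone $F\subseteq Q$, $0\in F$, such that $0\le_Q x\le_Q y$ and $y\in F$ imply $x\in F$. A Jordan subalgebra is a linear subspace closed under the product (not necessarily containing $e$). A linear subspace $M$ of $V$ is lattice-like if for all $x,y\in M$ the nearest point to $y$ in $x-Q$ and the nearest point to $y$ in $x+Q$ both belong to $M$. Let $\mathcal F(Q)$ be the family of faces of $Q$, $\mathcal A$ the family of Jordan subalgebras of $V$, and $\mathcal L$ the family of lattice-like linear subspaces of $V$. Then $$\{\operatorname{span}F:\ F\in\mathcal F(Q)\}\subsetneq\mathcal A\subsetneq\mathcal L .$$ Moreover, $V$ has a Jordan frame with at least two elements (a Jordan frame is a family $c_1,\dots,c_r$ of primitive idempotents with $c_ic_j=0$ for $i\ne j$ and $c_1+\dots+c_r=e$; an idempotent is primitive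 if it is nonzero and not the sum of two nonzero idempotents), and for every Jordan frame $c_1,\dots,c_r$ of $V$ and all indices $k\neq l$: 1. the subspace $\{\sum_i x_ic_i:\ x\in\mathbb R^r,\ x_k=x_l\}$ is a Jordan subalgebra of $V$ but is not the span of any face of $Q$; 2. if $a\in\mathbb R^r$ satisfies $a_ka_l<0$, $|a_k|\ne|a_l|$ and $a_i=0$ for $i\notin\{k,l\}$, then the hyperplane $\{\sum_i x_ic_i:\ x\in\mathbb R^r,\ \sum_i a_ix_i=0\}$ of $\operatorname{span}\{c_1,\dots,c_r\}$, with normal $a$ in the coordinates of the frame, is a lattice-like subspace of $V$ but not a Jordan subalgebra. -/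

import Mathlib

open scoped InnerProductSpace

/-- A Euclidean Jordan algebra structure on a real inner product space `V` (taken to be finite
dimensional where it is used): a commutative bilinear product with the Jordan identity and a unit,
for which the multiplication operators are symmetric. -/
class EuclideanJordanAlgebra (V : Type*) [NormedAddCommGroup V] [InnerProductSpace ℝ V] extends
    CommMagma V, One V, IsCommJordan V where
  protected one_mul : ∀ x : V, 1 * x = x
  protected add_mul : ∀ x y z : V, (x + y) * z = x * z + y * z
  protected smul_mul : ∀ (t : ℝ) (x y : V), (t • x) * y = t • (x * y)
  protected inner_mul : ∀ x y z : V, ⟪x * y, z⟫_ℝ = ⟪y, x * z⟫_ℝ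

namespace EuclideanJordanAlgebra

section Order

variable {V : Type*} [NormedAddCommGroup V] [InnerProductSpace ℝ V]

/-- The relation `x ≤_K y` induced by a cone `K`. -/
def ConeLE (K : Set V) (x y : V) : Prop := y - x ∈ K

/-- `p` is the metric projection `P_D x`: a nearest point to `x` in `D`
(unique as soon as `D` is convex). -/
def IsProjection (D : Set V) (x p : V) : Prop := p ∈ D ∧ ∀ y ∈ D, ‖x - p‖ ≤ ‖x - y‖

/-- `M` is lattice-like with respect to the closed convex cone `K`: for all `x, y ∈ M` the points
`x ⊓_K y = P_{x - K} y` and `x ⊔_K y = P_{x + K} y` belong to `M`. -/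
def IsLatticeLike (K M : Set V) : Prop :=
  ∀ x ∈ M, ∀ y ∈ M,
    (∃ p ∈ M, IsProjection ((fun k => x - k) '' K) y p) ∧
    (∃ p ∈ M, IsProjection ((fun k => x + k) '' K) y p)

/-- The subcone `F` is a face of `K`: `F ⊆ K`, and `0 ≤_K x ≤_K y`, `y ∈ F` imply `x ∈ F`.
(A `PointedCone` is a convex cone that contains `0`.) -/
def IsFace (K : Set V) (F : PointedCone ℝ V) : Prop :=
  (F : Set V) ⊆ K ∧ ∀ x y : V, ConeLE K 0 x → ConeLE K x y → y ∈ F → x ∈ F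

end Order

variable (V : Type*) [NormedAddCommGroup V] [InnerProductSpace ℝ V] [EuclideanJordanAlgebra V]

/-- The cone of squares `Q` of `V`. -/
def squares : Set V := Set.range fun x : V => x * x

/-- The family of the linear spans of the faces of `Q`. -/
def faceSpans : Set (Submodule ℝ V) :=
  {L | ∃ F : PointedCone ℝ V, IsFace (squares V) F ∧ L = Submodule.span ℝ (F : Set V)}

/-- The family of the Jordan subalgebras of `V`: the linear subspaces closed under the product
(they need not contain the unit of `V`). -/
def subalgebras : Set (Submodule ℝ V) :=
  {L | ∀ x ∈ L, ∀ y ∈ L, x * y ∈ L}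

/-- The family of the lattice-like linear subspaces of `(V, Q)`. -/
def latticeLikeSubspaces : Set (Submodule ℝ V) :=
  {L | IsLatticeLike (squares V) (L : Set V)}

variable {V}

/-- A nonzero idempotent that is not the sum of two nonzero idempotents. -/
def IsPrimitiveIdempotent (c : V) : Prop :=
  IsIdempotentElem c ∧ c ≠ 0 ∧
    ¬ ∃ a b : V, IsIdempotentElem a ∧ IsIdempotentElem b ∧ a ≠ 0 ∧ b ≠ 0 ∧ c = a + b

/-- A Jordan frame: primitive idempotents with pairwise zero products that sum to the unit. -/
structure IsJordanFrame {r : ℕ} (c : Fin r → V) : Prop where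
  primitive : ∀ i, IsPrimitiveIdempotent (c i)
  mul_eq_zero : ∀ i j, i ≠ j → c i * c j = 0
  sum_eq_one : ∑ i, c i = 1

/-- The subspace `{∑ i, x i • c i | ∑ i, a i * x i = 0}` of the span of the frame `c`: the
hyperplane of that span whose normal, in frame coordinates, is `a`. -/
def frameHyperplane {r : ℕ} (c : Fin r → V) (a : Fin r → ℝ) : Submodule ℝ V :=
  (LinearMap.ker (Fintype.linearCombination ℝ a)).map (Fintype.linearCombination ℝ c)

/-- The subspace `{∑ i, x i • c i | x k = x l}` of the span of the frame `c`. -/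
def frameDiagonal {r : ℕ} (c : Fin r → V) (k l : Fin r) : Submodule ℝ V :=
  (LinearMap.eqLocus (LinearMap.proj (R := ℝ) (φ := fun _ : Fin r => ℝ) k)
    (LinearMap.proj l)).map (Fintype.linearCombination ℝ c)

end EuclideanJordanAlgebra

/-! Power associativity and the symmetry of `mulLeft x` give a spectral decomposition x = ∑ s • c_s
with orthogonal idempotents c_s (`sum_spectral`). Multiplication by an idempotent is positive
semidefinite, so any two squares have nonnegative inner product. Hence ∑ max(s, 0) • c_s is the
nearest point of Q to x, and a subspace containing the positive parts of its elements is
lattice-like. A subalgebra contains c_s for s ≠ 0, so it qualifies.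

If f lies in a face, then f² ≤ C f for some C ≥ 0, so f² lies in the face too; polarization makes
the span a subalgebra.

Strictness is visible in frame coordinates, where products and positive parts are taken
coordinatewise. The condition x_k = x_l survives products, but a face whose span contains e contains
e itself and then every c_k. The condition x_l = t x_k with t > 0 survives positive parts, but
survives squaring only for t = 1. A frame exists because a complete orthogonal family of nonzero
idempotents of maximal size cannot be refined. -/

namespace EuclideanJordanAlgebra

/-! ### Jordan identities, power associativity, positivity of idempotents -/

section Basic

variable {V : Type*} [NormedAddCommGroup V] [InnerProductSpace ℝ V] [EuclideanJordanAlgebra V]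

/-- The Jordan product as a bilinear map. -/
def mulLeft : V →ₗ[ℝ] V →ₗ[ℝ] V :=
  LinearMap.mk₂ ℝ (fun x y => x * y) EuclideanJordanAlgebra.add_mul
    EuclideanJordanAlgebra.smul_mul
    (fun x y z => by
      rw [mul_comm x, EuclideanJordanAlgebra.add_mul, mul_comm y, mul_comm z])
    (fun t x y => by rw [mul_comm x, EuclideanJordanAlgebra.smul_mul, mul_comm y])

@[simp]
theorem mulLeft_apply (x y : V) : mulLeft x y = x * y := rfl

/-- The linearised Jordan identity. -/
theorem jordan_linearized (a b c d : V) :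
    (a * b) * (c * d) + (b * c) * (a * d) + (c * a) * (b * d) =
      c * ((a * b) * d) + a * ((b * c) * d) + b * ((c * a) * d) := by
  let _ : NonUnitalNonAssocCommRing V :=
    { (inferInstance : AddCommGroup V), (inferInstance : CommMagma V) with
      left_distrib := fun x y z => (mulLeft x).map_add y z
      right_distrib := fun x y z => EuclideanJordanAlgebra.add_mul x y z
      zero_mul := fun x => mulLeft.map_zero₂ x
      mul_zero := fun x => (mulLeft x).map_zero }
  have h := two_nsmul_lie_lmul_lmul_add_add_eq_zero a b c
  have h2 : 2 • ((a * ((b * c) * d) - (b * c) * (a * d)) +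
      (b * ((c * a) * d) - (c * a) * (b * d)) +
      (c * ((a * b) * d) - (a * b) * (c * d))) = 0 := DFunLike.congr_fun h d
  rw [← sub_eq_zero]
  have h3 : (2 : ℝ) • ((a * b) * (c * d) + (b * c) * (a * d) + (c * a) * (b * d) -
      (c * ((a * b) * d) + a * ((b * c) * d) + b * ((c * a) * d))) = 0 := by
    rw [ofNat_smul_eq_nsmul, ← neg_eq_zero, ← h2, ← smul_neg]
    congr 1
    abel
  exact (smul_eq_zero.mp h3).resolve_left two_ne_zero

/-- Two instances of the linearised identity, with y and d exchanged, are compared. For y a power of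
x this is a recursion for the multiplication operators of powers; for x = y = c idempotent it is the
cubic equation 2T³ - 3T² + T = 0 for T = `mulLeft c`. -/
theorem mulLeft_mul_self_mul (x y : V) :
    mulLeft ((x * x) * y) = mulLeft y * mulLeft (x * x) +
      (2 : ℝ) • (mulLeft x * mulLeft (x * y)) - (2 : ℝ) • (mulLeft x * mulLeft y * mulLeft x) := by
  ext d
  have h1 := jordan_linearized x x y d
  have h2 := jordan_linearized x x d y
  simp only [LinearMap.sub_apply, LinearMap.add_apply,
    Module.End.mul_apply, mulLeft_apply, two_smul]
  rw [mul_comm d y, mul_comm y x] at *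
  rw [mul_comm d x] at h2
  rw [mul_comm (x * x * y) d, mul_comm y (x * d)]
  have h3 : d * (x * x * y) + x * (x * d * y) + x * (x * d * y) =
      y * (x * x * d) + x * (x * y * d) + x * (x * y * d) := by
    rw [← h1, ← h2, mul_comm (x * d)]
  rw [eq_sub_iff_add_eq, ← add_assoc, h3, add_assoc]

theorem commute_mulLeft_mul_self (x : V) : Commute (mulLeft x) (mulLeft (x * x)) := by
  ext y
  simp only [Module.End.mul_apply, mulLeft_apply]
  have := IsCommJordan.lmul_comm_rmul_rmul x y
  rw [mul_comm (x * x) y, ← this, mul_comm]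

theorem mulLeft_one : mulLeft (1 : V) = 1 := by
  ext y; exact EuclideanJordanAlgebra.one_mul y

theorem mul_one' (x : V) : x * 1 = x := by
  rw [mul_comm, EuclideanJordanAlgebra.one_mul]

theorem commute_mulLeft_pow (x : V) (n : ℕ) :
    Commute (mulLeft x) (mulLeft ((mulLeft x ^ n) 1)) := by
  induction n using Nat.twoStepInduction with
  | zero => simp [mulLeft_one]
  | one => simp [mul_one']
  | more n ih0 ih1 =>
    -- Since `mulLeft (x * x)` commutes with `mulLeft x`, the (n+2)-nd power has the form x² y
    -- required by `mulLeft_mul_self_mul`.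
    have h : (mulLeft x ^ (n + 2)) 1 = (x * x) * (mulLeft x ^ n) 1 := by
      have := DFunLike.congr_fun ((commute_mulLeft_mul_self x).pow_left n).eq 1
      simp only [Module.End.mul_apply, mulLeft_apply, mul_one'] at this
      rw [← this, pow_add, Module.End.mul_apply]
      simp [pow_two, mul_one']
    have h' : x * (mulLeft x ^ n) 1 = (mulLeft x ^ (n + 1)) 1 := by
      rw [pow_succ']; rfl
    rw [h, mulLeft_mul_self_mul, h']
    have hx := commute_mulLeft_mul_self x
    exact ((ih0.mul_right hx).add_right (((Commute.refl _).mul_right ih1).smul_right _)).sub_right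
      ((((Commute.refl _).mul_right ih0).mul_right (Commute.refl _)).smul_right _)

open Polynomial in
theorem commute_mulLeft_aeval (x : V) (p : ℝ[X]) :
    Commute (mulLeft x) (mulLeft (aeval (mulLeft x) p 1)) := by
  induction p using Polynomial.induction_on' with
  | add p q hp hq => simpa using hp.add_right hq
  | monomial n a =>
    simpa [aeval_monomial, Algebra.algebraMap_eq_smul_one] using
      (commute_mulLeft_pow x n).smul_right a

/-- Power associativity. -/
theorem aeval_mul_aeval (x : V) (p q : Polynomial ℝ) :
    Polynomial.aeval (mulLeft x) p 1 * Polynomial.aeval (mulLeft x) q 1 =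
      Polynomial.aeval (mulLeft x) (p * q) 1 := by
  -- Multiplication by p(x) commutes with `mulLeft x`, hence with q(`mulLeft x`); evaluating at 1
  -- gives the claim.
  have h : Commute (Polynomial.aeval (mulLeft x) q)
      (mulLeft (Polynomial.aeval (mulLeft x) p 1)) := by
    induction q using Polynomial.induction_on' with
    | add q r hq hr => simpa using hq.add_left hr
    | monomial n a =>
      simpa [Polynomial.aeval_monomial, Algebra.algebraMap_eq_smul_one] using
        ((commute_mulLeft_aeval x p).pow_left n).smul_left a
  have := DFunLike.congr_fun h.eq 1
  simp only [Module.End.mul_apply, mulLeft_apply, mul_one'] at this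
  rw [← this, mul_comm p q, map_mul, Module.End.mul_apply]

theorem isSymmetric_mulLeft (x : V) : (mulLeft x).IsSymmetric := fun y z =>
  EuclideanJordanAlgebra.inner_mul x y z

/-- The cubic equation for T = `mulLeft c` implies T = T² + 4 (T - T²)². This shows both that T is
positive semidefinite and that its quadratic form vanishes only on its kernel. -/
theorem inner_mul_self_of_isIdempotentElem {c : V} (hc : IsIdempotentElem c) (x : V) :
    ⟪c * x, x⟫_ℝ = ‖c * x‖ ^ 2 + 4 * ‖c * x - c * (c * x)‖ ^ 2 := by
  have h := DFunLike.congr_fun (mulLeft_mul_self_mul c c) x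
  rw [hc.eq, hc.eq] at h
  simp only [LinearMap.sub_apply, LinearMap.add_apply, LinearMap.smul_apply,
    Module.End.mul_apply, mulLeft_apply] at h
  have e (y z : V) := EuclideanJordanAlgebra.inner_mul c y z
  -- Pairing the cubic with x and with T x eliminates the terms in T³ and T⁴.
  have h1 := congrArg (fun w => ⟪w, x⟫_ℝ) h
  have h2 := congrArg (fun w => ⟪w, c * x⟫_ℝ) h
  simp only [inner_sub_left, inner_add_left, inner_smul_left] at h1 h2
  rw [← real_inner_self_eq_norm_sq, ← real_inner_self_eq_norm_sq]
  simp only [inner_sub_left, inner_sub_right]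
  simp only [e, RCLike.conj_to_real] at *
  linarith

theorem inner_mul_self_nonneg {c : V} (hc : IsIdempotentElem c) (x : V) : 0 ≤ ⟪c * x, x⟫_ℝ := by
  rw [inner_mul_self_of_isIdempotentElem hc]; positivity

theorem mul_eq_zero_of_inner_eq_zero {c : V} (hc : IsIdempotentElem c) {x : V}
    (h : ⟪c * x, x⟫_ℝ = 0) : c * x = 0 := by
  rw [inner_mul_self_of_isIdempotentElem hc] at h
  have := sq_nonneg ‖c * x - c * (c * x)‖
  have := sq_nonneg ‖c * x‖
  exact norm_eq_zero.mp (pow_eq_zero_iff two_ne_zero |>.mp (by linarith))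

theorem inner_eq_zero_of_mul_eq_zero {x y : V} (h : x * y = 0) : ⟪x, y⟫_ℝ = 0 := by
  have := EuclideanJordanAlgebra.inner_mul x 1 y
  rwa [mul_one', h, inner_zero_right] at this

theorem mul_eq_zero_of_add {a b : V} (ha : a * a = a) (hb : b * b = b)
    (hab : (a + b) * (a + b) = a + b) : a * b = 0 := by
  rw [EuclideanJordanAlgebra.add_mul, mul_comm a, mul_comm b, EuclideanJordanAlgebra.add_mul,
    EuclideanJordanAlgebra.add_mul, ha, hb, mul_comm b a] at hab
  have h : (2 : ℝ) • (a * b) = 0 := by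
    rw [two_smul, ← sub_eq_zero.mpr hab]
    abel
  exact (smul_eq_zero.mp h).resolve_left two_ne_zero

theorem mul_eq_zero_of_add_mul_eq_zero {a b d : V} (ha : a * a = a) (hb : b * b = b)
    (h : (a + b) * d = 0) : a * d = 0 := by
  have h1 := inner_mul_self_nonneg (show IsIdempotentElem a from ha) d
  have h2 := inner_mul_self_nonneg (show IsIdempotentElem b from hb) d
  have h3 : ⟪a * d, d⟫_ℝ + ⟪b * d, d⟫_ℝ = 0 := by
    rw [← inner_add_left, ← EuclideanJordanAlgebra.add_mul, h, inner_zero_left]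
  exact mul_eq_zero_of_inner_eq_zero ha (by linarith)

end Basic

/-! ### Spectral decomposition and positivity of the cone of squares -/

section Spectral

variable {V : Type*} [NormedAddCommGroup V] [InnerProductSpace ℝ V] [EuclideanJordanAlgebra V]

/-- A family of idempotents with pairwise zero products. -/
structure IsOrthogonalFamily {ι : Type*} (c : ι → V) : Prop where
  idem : ∀ i, c i * c i = c i
  mul_eq_zero : ∀ i j, i ≠ j → c i * c j = 0

theorem IsJordanFrame.isOrthogonalFamily {r : ℕ} {c : Fin r → V} (hc : IsJordanFrame c) :
    IsOrthogonalFamily c :=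
  ⟨fun i => (hc.primitive i).1, hc.mul_eq_zero⟩

namespace IsOrthogonalFamily

variable {ι : Type*} [Fintype ι] {c : ι → V}

theorem sum_smul_mul_sum_smul (hc : IsOrthogonalFamily c) (x y : ι → ℝ) :
    (∑ i, x i • c i) * (∑ i, y i • c i) = ∑ i, (x i * y i) • c i := by
  classical
  rw [← mulLeft_apply, map_sum mulLeft, LinearMap.sum_apply]
  refine Finset.sum_congr rfl fun i _ => ?_
  rw [map_sum, Finset.sum_eq_single i]
  · rw [map_smul, map_smul, LinearMap.smul_apply, mulLeft_apply, hc.idem, smul_smul, mul_comm]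
  · intro j _ hj
    rw [map_smul, map_smul, LinearMap.smul_apply, mulLeft_apply, hc.mul_eq_zero i j hj.symm,
      smul_zero, smul_zero]
  · simp

theorem sum_smul_mem_squares (hc : IsOrthogonalFamily c) {x : ι → ℝ} (hx : ∀ i, 0 ≤ x i) :
    ∑ i, x i • c i ∈ squares V := by
  refine ⟨∑ i, √(x i) • c i, ?_⟩
  simp only [hc.sum_smul_mul_sum_smul, Real.mul_self_sqrt (hx _)]

theorem mul_sum_smul (hc : IsOrthogonalFamily c) (x : ι → ℝ) (i : ι) :
    c i * ∑ j, x j • c j = x i • c i := by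
  classical
  have := hc.sum_smul_mul_sum_smul (Pi.single i 1) x
  simpa [Pi.single_apply] using this

theorem linearIndependent (hc : IsOrthogonalFamily c) (h0 : ∀ i, c i ≠ 0) :
    LinearIndependent ℝ c := by
  rw [Fintype.linearIndependent_iff]
  intro x hx i
  have h := hc.mul_sum_smul x i
  rw [hx, ← mulLeft_apply, map_zero] at h
  exact (smul_eq_zero.mp h.symm).resolve_right (h0 i)

theorem positive_part (hc : IsOrthogonalFamily c) (x : ι → ℝ) :
    ∑ i, max (x i) 0 • c i ∈ squares V ∧
      ∑ i, max (x i) 0 • c i - ∑ i, x i • c i ∈ squares V ∧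
      ⟪∑ i, max (x i) 0 • c i, ∑ i, max (x i) 0 • c i - ∑ i, x i • c i⟫_ℝ = 0 := by
  rw [← Finset.sum_sub_distrib]
  simp only [← sub_smul]
  refine ⟨hc.sum_smul_mem_squares fun i => le_max_right _ _,
    hc.sum_smul_mem_squares fun i => sub_nonneg.mpr (le_max_left _ _),
    inner_eq_zero_of_mul_eq_zero ?_⟩
  rw [hc.sum_smul_mul_sum_smul]
  refine Finset.sum_eq_zero fun i _ => ?_
  rcases max_choice (x i) 0 with h | h <;> simp [h]

end IsOrthogonalFamily

variable [FiniteDimensional ℝ V]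

/-- The eigenvalues of the multiplication operator of `x`, together with `0`. -/
noncomputable def nodes (x : V) : Finset ℝ :=
  insert 0 (Finset.univ.image ((isSymmetric_mulLeft x).eigenvalues rfl))

open Polynomial

/-- A symmetric operator is diagonalizable, so a polynomial in it is determined by its values on the
eigenvalues. -/
theorem aeval_mulLeft_congr (x : V) {p q : ℝ[X]} (h : ∀ s ∈ nodes x, p.eval s = q.eval s) :
    aeval (mulLeft x) p = aeval (mulLeft x) q := by
  refine ((isSymmetric_mulLeft x).eigenvectorBasis rfl).toBasis.ext fun i => ?_
  have hi := (isSymmetric_mulLeft x).hasEigenvector_eigenvectorBasis rfl i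
  rw [OrthonormalBasis.coe_toBasis, Module.End.aeval_apply_of_hasEigenvector hi,
    Module.End.aeval_apply_of_hasEigenvector hi, RCLike.ofReal_real_eq_id, id, h]
  exact Finset.mem_insert_of_mem (Finset.mem_image_of_mem _ (Finset.mem_univ i))

/-- The spectral idempotent of `x` at `s`. -/
noncomputable def spectralIdempotent (x : V) (s : nodes x) : V :=
  aeval (mulLeft x) (Lagrange.basis (nodes x) id (s : ℝ)) 1

theorem eval_basis_nodes (x : V) (s t : nodes x) :
    (Lagrange.basis (nodes x) id (s : ℝ)).eval (t : ℝ) = if s = t then 1 else 0 := by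
  split_ifs with h
  · subst h
    exact Lagrange.eval_basis_self (v := id) (Set.injOn_id _) s.2
  · exact Lagrange.eval_basis_of_ne (v := id) (fun h' => h (Subtype.ext h')) t.2

theorem isOrthogonalFamily_spectralIdempotent (x : V) :
    IsOrthogonalFamily (spectralIdempotent x) where
  idem s := by
    rw [spectralIdempotent, aeval_mul_aeval]
    congr 1
    refine aeval_mulLeft_congr x fun t ht => ?_
    rw [eval_mul, eval_basis_nodes x s ⟨t, ht⟩]
    split_ifs <;> simp
  mul_eq_zero s s' hs := by
    rw [spectralIdempotent, spectralIdempotent, aeval_mul_aeval]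
    rw [aeval_mulLeft_congr x (q := 0), map_zero, LinearMap.zero_apply]
    intro t ht
    rw [eval_mul, eval_basis_nodes x s ⟨t, ht⟩, eval_basis_nodes x s' ⟨t, ht⟩]
    split_ifs with h h' <;> simp
    exact hs (h.trans h'.symm)

theorem sum_smul_spectralIdempotent (x : V) (p : ℝ[X]) :
    ∑ s : nodes x, p.eval (s : ℝ) • spectralIdempotent x s = aeval (mulLeft x) p 1 := by
  have h : aeval (mulLeft x) p =
      aeval (mulLeft x) (∑ s : nodes x, p.eval (s : ℝ) • Lagrange.basis (nodes x) id (s : ℝ)) := by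
    refine aeval_mulLeft_congr x fun t ht => ?_
    simp only [eval_finsetSum, eval_smul, smul_eq_mul]
    simp only [eval_basis_nodes x _ ⟨t, ht⟩]
    simp
  rw [h, map_sum, LinearMap.sum_apply]
  simp [spectralIdempotent]

theorem sum_spectral (x : V) : ∑ s : nodes x, (s : ℝ) • spectralIdempotent x s = x := by
  simpa [mul_one'] using sum_smul_spectralIdempotent x X

/-- Since 0 is always a node, the Lagrange polynomial at s ≠ 0 vanishes at 0 and is divisible by X.
The idempotent is therefore a polynomial in x without constant term, and L need not contain the
unit. -/
theorem spectralIdempotent_mem {L : Submodule ℝ V} (hL : L ∈ subalgebras V) {x : V} (hx : x ∈ L)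
    (s : nodes x) (hs : (s : ℝ) ≠ 0) : spectralIdempotent x s ∈ L := by
  have h0 : (Lagrange.basis (nodes x) id (s : ℝ)).eval 0 = 0 := by
    rw [eval_basis_nodes x s ⟨0, Finset.mem_insert_self _ _⟩, if_neg]
    exact fun h => hs (congrArg Subtype.val h)
  obtain ⟨q, hq⟩ := X_dvd_iff.mpr ((coeff_zero_eq_eval_zero _).trans h0)
  rw [spectralIdempotent, hq, mul_comm, map_mul, aeval_X, Module.End.mul_apply, mulLeft_apply,
    mul_one']
  clear hq
  induction q using Polynomial.induction_on' with
  | add p q hp hq => simpa using L.add_mem hp hq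
  | monomial n a =>
    rw [aeval_monomial, Algebra.algebraMap_eq_smul_one, smul_mul_assoc, LinearMap.smul_apply]
    refine L.smul_mem _ ?_
    rw [_root_.one_mul]
    induction n with
    | zero => simpa
    | succ n ih => rw [pow_succ', Module.End.mul_apply]; exact hL x hx _ ih

theorem mul_self_eq_sum_spectral (x : V) :
    x * x = ∑ s : nodes x, ((s : ℝ) * s) • spectralIdempotent x s := by
  conv_lhs => rw [← sum_spectral x]
  exact (isOrthogonalFamily_spectralIdempotent x).sum_smul_mul_sum_smul _ _

/-- Expanding x² = ∑ s² • c_s reduces the claim to ⟪c_s, y²⟫ = ⟪c_s y, y⟫ ≥ 0. -/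
theorem inner_nonneg_of_mem_squares {x y : V} (hx : x ∈ squares V) (hy : y ∈ squares V) :
    0 ≤ ⟪x, y⟫_ℝ := by
  obtain ⟨x, rfl⟩ := hx
  obtain ⟨y, rfl⟩ := hy
  dsimp only
  rw [mul_self_eq_sum_spectral x, sum_inner]
  refine Finset.sum_nonneg fun s _ => ?_
  rw [inner_smul_left, real_inner_comm, EuclideanJordanAlgebra.inner_mul, real_inner_comm,
    mul_comm y]
  exact mul_nonneg (mul_self_nonneg _)
    (inner_mul_self_nonneg ((isOrthogonalFamily_spectralIdempotent x).idem s) y)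

end Spectral

/-! ### The two inclusions -/

section Lattice

variable {V : Type*} [NormedAddCommGroup V] [InnerProductSpace ℝ V] [FiniteDimensional ℝ V]
  [EuclideanJordanAlgebra V]

/-- Moreau's characterisation of the nearest point in the self-dual cone of squares. -/
theorem norm_sub_le_of_inner_eq_zero {z p q : V} (hpz : p - z ∈ squares V)
    (h : ⟪p, p - z⟫_ℝ = 0) (hq : q ∈ squares V) : ‖z - p‖ ≤ ‖z - q‖ := by
  have h1 := inner_nonneg_of_mem_squares hpz hq
  have h2 : ‖z - q‖ ^ 2 = ‖z - p‖ ^ 2 + 2 * ⟪p - z, q⟫_ℝ + ‖p - q‖ ^ 2 := by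
    have e : z - q = (p - q) - (p - z) := by abel
    rw [e, norm_sub_sq_real, norm_sub_rev z p, real_inner_comm, inner_sub_right,
      real_inner_comm p, h]
    ring
  refine (sq_le_sq₀ (norm_nonneg _) (norm_nonneg _)).mp ?_
  nlinarith [sq_nonneg ‖p - q‖]

/-- By translation and reflection, the projections of y onto x - Q and x + Q are x - P_Q(x - y) and
x + P_Q(y - x); the p of the hypothesis is P_Q z. -/
theorem mem_latticeLikeSubspaces {M : Submodule ℝ V}
    (h : ∀ z ∈ M, ∃ p ∈ M, p ∈ squares V ∧ p - z ∈ squares V ∧ ⟪p, p - z⟫_ℝ = 0) :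
    M ∈ latticeLikeSubspaces V := by
  intro x hx y hy
  constructor
  · obtain ⟨p, hpM, hp, hpz, h0⟩ := h (x - y) (M.sub_mem hx hy)
    refine ⟨x - p, M.sub_mem hx hpM, ⟨p, hp, rfl⟩, ?_⟩
    rintro _ ⟨q, hq, rfl⟩
    have := norm_sub_le_of_inner_eq_zero hpz h0 hq
    have e (w : V) : y - (x - w) = -((x - y) - w) := by abel
    simpa only [e, norm_neg] using this
  · obtain ⟨p, hpM, hp, hpz, h0⟩ := h (y - x) (M.sub_mem hy hx)
    refine ⟨x + p, M.add_mem hx hpM, ⟨p, hp, rfl⟩, ?_⟩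
    rintro _ ⟨q, hq, rfl⟩
    simpa only [sub_add_eq_sub_sub] using norm_sub_le_of_inner_eq_zero hpz h0 hq

theorem subalgebras_subset_latticeLikeSubspaces :
    subalgebras V ⊆ latticeLikeSubspaces V := by
  intro L hL
  refine mem_latticeLikeSubspaces fun z hz => ?_
  have h := (isOrthogonalFamily_spectralIdempotent z).positive_part (fun s => (s : ℝ))
  rw [sum_spectral z] at h
  refine ⟨_, L.sum_mem fun s _ => ?_, h⟩
  by_cases hs : (s : ℝ) = 0
  · simp [hs]
  · exact L.smul_mem _ (spectralIdempotent_mem hL hz s hs)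

/-- For f = x² with x = ∑ s • c_s, the coefficients satisfy s⁴ ≤ C s² with C the sum of all t². -/
theorem exists_smul_sub_mul_self_mem_squares {f : V} (hf : f ∈ squares V) :
    ∃ C : ℝ, 0 ≤ C ∧ C • f - f * f ∈ squares V := by
  obtain ⟨x, rfl⟩ := hf
  have hc := isOrthogonalFamily_spectralIdempotent x
  dsimp only
  rw [mul_self_eq_sum_spectral x, hc.sum_smul_mul_sum_smul]
  have hC (s : nodes x) : (s : ℝ) * s ≤ ∑ t : nodes x, (t : ℝ) * t :=
    Finset.single_le_sum (f := fun t : nodes x => (t : ℝ) * t)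
      (fun t _ => mul_self_nonneg _) (Finset.mem_univ s)
  refine ⟨∑ t : nodes x, (t : ℝ) * t, Finset.sum_nonneg fun t _ => mul_self_nonneg _, ?_⟩
  simp only [Finset.smul_sum, smul_smul]
  rw [← Finset.sum_sub_distrib]
  simp only [← sub_smul, ← sub_mul]
  exact hc.sum_smul_mem_squares fun s =>
    mul_nonneg (sub_nonneg.mpr (hC s)) (mul_self_nonneg _)

theorem faceSpans_subset_subalgebras : faceSpans V ⊆ subalgebras V := by
  rintro _ ⟨F, ⟨hFQ, hF⟩, rfl⟩
  set S := Submodule.span ℝ (F : Set V) with hS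
  have hsq : ∀ f ∈ F, f * f ∈ S := by
    intro f hf
    obtain ⟨C, hC, h⟩ := exists_smul_sub_mul_self_mem_squares (hFQ hf)
    refine Submodule.subset_span (hF (f * f) (C • f) ?_ h (F.smul_mem hC hf))
    exact ⟨f, (sub_zero _).symm⟩
  have hmul : ∀ f ∈ F, ∀ g ∈ F, f * g ∈ S := by
    intro f hf g hg
    have e : f * g = (2⁻¹ : ℝ) • ((f + g) * (f + g) - f * f - g * g) := by
      have : (f + g) * (f + g) = f * f + f * g + (f * g + g * g) := by
        rw [← mulLeft_apply, map_add, map_add, LinearMap.add_apply, LinearMap.add_apply]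
        simp only [mulLeft_apply, mul_comm g f]
      rw [this, eq_inv_smul_iff₀ two_ne_zero, two_smul]
      abel
    rw [e]
    exact S.smul_mem _ (S.sub_mem (S.sub_mem (hsq _ (F.add_mem hf hg)) (hsq _ hf)) (hsq _ hg))
  intro x hx y hy
  have h : S ≤ (S.comap (mulLeft y)) := by
    refine Submodule.span_le.mpr fun f hf => ?_
    change y * f ∈ S
    rw [mul_comm]
    have h2 : S ≤ S.comap (mulLeft f) := Submodule.span_le.mpr fun g hg => hmul f hf g hg
    exact h2 hy
  rw [mul_comm]
  exact h hx

end Lattice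

/-! ### Witnesses for strictness in frame coordinates -/

section Frame

variable {V : Type*} [NormedAddCommGroup V] [InnerProductSpace ℝ V]

theorem mem_frameDiagonal {r : ℕ} {c : Fin r → V} {k l : Fin r} {z : V} :
    z ∈ frameDiagonal c k l ↔ ∃ x : Fin r → ℝ, x k = x l ∧ ∑ i, x i • c i = z := by
  simp [frameDiagonal, LinearMap.mem_eqLocus, Fintype.linearCombination_apply]

theorem mem_frameHyperplane {r : ℕ} {c : Fin r → V} {a : Fin r → ℝ} {z : V} :
    z ∈ frameHyperplane c a ↔ ∃ x : Fin r → ℝ, ∑ i, x i * a i = 0 ∧ ∑ i, x i • c i = z := by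
  simp [frameHyperplane, Fintype.linearCombination_apply]

/-- The span of a convex cone is F - F; consequently an element of Q in the span of a face is
dominated by an element of the face. -/
theorem exists_add_eq_of_mem_span {F : PointedCone ℝ V} {x : V}
    (hx : x ∈ Submodule.span ℝ (F : Set V)) : ∃ f ∈ F, ∃ g ∈ F, x + g = f := by
  induction hx using Submodule.span_induction with
  | mem x hx => exact ⟨x, hx, 0, F.zero_mem, add_zero x⟩
  | zero => exact ⟨0, F.zero_mem, 0, F.zero_mem, add_zero 0⟩
  | add x y _ _ hx hy =>
    obtain ⟨f, hf, g, hg, rfl⟩ := hx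
    obtain ⟨f', hf', g', hg', rfl⟩ := hy
    exact ⟨_, F.add_mem hf hf', g + g', F.add_mem hg hg', by abel⟩
  | smul t x _ hx =>
    obtain ⟨f, hf, g, hg, rfl⟩ := hx
    rcases le_total 0 t with ht | ht
    · exact ⟨t • (x + g), F.smul_mem ht hf, t • g, F.smul_mem ht hg,
        (smul_add t x g).symm⟩
    · refine ⟨(-t) • g, F.smul_mem (neg_nonneg.mpr ht) hg, (-t) • (x + g),
        F.smul_mem (neg_nonneg.mpr ht) hf, ?_⟩
      rw [smul_add, neg_smul, neg_smul]
      abel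

variable [EuclideanJordanAlgebra V]

theorem IsOrthogonalFamily.frameDiagonal_mem_subalgebras {r : ℕ} {c : Fin r → V}
    (hc : IsOrthogonalFamily c) (k l : Fin r) : frameDiagonal c k l ∈ subalgebras V := by
  intro x hx y hy
  obtain ⟨x, hxkl, rfl⟩ := mem_frameDiagonal.mp hx
  obtain ⟨y, hykl, rfl⟩ := mem_frameDiagonal.mp hy
  exact mem_frameDiagonal.mpr ⟨fun i => x i * y i, by simp only [hxkl, hykl],
    (hc.sum_smul_mul_sum_smul x y).symm⟩

theorem IsJordanFrame.linearIndependent {r : ℕ} {c : Fin r → V} (hc : IsJordanFrame c) :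
    LinearIndependent ℝ c :=
  hc.isOrthogonalFamily.linearIndependent fun i => (hc.primitive i).2.1

theorem IsJordanFrame.frameDiagonal_notMem_faceSpans {r : ℕ} {c : Fin r → V}
    (hc : IsJordanFrame c) {k l : Fin r} (hkl : k ≠ l) : frameDiagonal c k l ∉ faceSpans V := by
  rintro ⟨F, ⟨hFQ, hF⟩, hspan⟩
  have h1 : (1 : V) ∈ frameDiagonal c k l :=
    mem_frameDiagonal.mpr ⟨fun _ => 1, rfl, by simpa using hc.sum_eq_one⟩
  rw [hspan] at h1
  obtain ⟨f, hf, g, hg, h⟩ := exists_add_eq_of_mem_span h1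
  have h1F : (1 : V) ∈ F := by
    refine hF 1 f ⟨1, ?_⟩ ?_ hf
    · rw [sub_zero]
      exact mul_one' 1
    · rw [ConeLE, ← h, add_sub_cancel_left]
      exact hFQ hg
  have hkF : c k ∈ F := by
    refine hF (c k) 1 ⟨c k, ?_⟩ ?_ h1F
    · rw [sub_zero]
      exact (hc.primitive k).1
    · have e : (1 : V) - c k = ∑ i, (if i = k then (0 : ℝ) else 1) • c i := by
        rw [← hc.sum_eq_one, sub_eq_iff_eq_add, ← Finset.sum_erase_add _ _ (Finset.mem_univ k),
          ← Finset.sum_erase_add (a := k) Finset.univ (fun i => (if i = k then (0 : ℝ) else 1) • c i)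
            (Finset.mem_univ k)]
        simp only [if_true, zero_smul, add_zero]
        congr 1
        refine Finset.sum_congr rfl fun i hi => ?_
        rw [if_neg (Finset.ne_of_mem_erase hi), one_smul]
      rw [ConeLE, e]
      refine hc.isOrthogonalFamily.sum_smul_mem_squares fun i => ?_
      split_ifs <;> norm_num
  -- The k-th and l-th coordinates of c k are 1 and 0, so it cannot lie in the diagonal.
  have hk : c k ∈ frameDiagonal c k l := hspan ▸ Submodule.subset_span hkF
  obtain ⟨x, hx, hxc⟩ := mem_frameDiagonal.mp hk
  have hxk := hc.isOrthogonalFamily.mul_sum_smul x k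
  have hxl := hc.isOrthogonalFamily.mul_sum_smul x l
  rw [hxc] at hxk hxl
  rw [hc.mul_eq_zero l k hkl.symm] at hxl
  have hl0 := (smul_eq_zero.mp hxl.symm).resolve_right (hc.primitive l).2.1
  rw [hx, hl0, zero_smul, (hc.primitive k).1] at hxk
  exact (hc.primitive k).2.1 hxk

theorem sum_mul_eq_of_support {r : ℕ} {a : Fin r → ℝ} {k l : Fin r} (hkl : k ≠ l)
    (ha : ∀ i, i ≠ k → i ≠ l → a i = 0) (x : Fin r → ℝ) :
    ∑ i, x i * a i = x k * a k + x l * a l := by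
  rw [← Finset.sum_pair (f := fun i => x i * a i) hkl]
  refine (Finset.sum_subset (Finset.subset_univ _) fun i _ hi => ?_).symm
  rw [Finset.mem_insert, Finset.mem_singleton, not_or] at hi
  rw [ha i hi.1 hi.2, mul_zero]

theorem IsJordanFrame.frameHyperplane_notMem_subalgebras {r : ℕ} {c : Fin r → V}
    (hc : IsJordanFrame c) {k l : Fin r} (hkl : k ≠ l) {a : Fin r → ℝ} (h0 : a k * a l < 0)
    (hne : |a k| ≠ |a l|) (ha : ∀ i, i ≠ k → i ≠ l → a i = 0) :
    frameHyperplane c a ∉ subalgebras V := by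
  intro h
  -- This vector is orthogonal to a, while its coordinatewise square pairs with a to a_k a_l (a_k +
  -- a_l) ≠ 0.
  let x : Fin r → ℝ := fun i => if i = k then a l else if i = l then -a k else 0
  have hxk : x k = a l := if_pos rfl
  have hxl : x l = -a k := by simp [x, hkl.symm]
  have hx : ∑ i, x i • c i ∈ frameHyperplane c a := by
    refine mem_frameHyperplane.mpr ⟨x, ?_, rfl⟩
    rw [sum_mul_eq_of_support hkl ha, hxk, hxl]
    ring
  obtain ⟨y, hy, hyx⟩ := mem_frameHyperplane.mp (h _ hx _ hx)
  rw [hc.isOrthogonalFamily.sum_smul_mul_sum_smul] at hyx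
  have hyx' : y = fun i => x i * x i := by
    have := Fintype.linearIndependent_iff.mp hc.linearIndependent (fun i => y i - x i * x i)
      (by simp only [sub_smul, Finset.sum_sub_distrib, hyx, sub_self])
    exact funext fun i => sub_eq_zero.mp (this i)
  rw [sum_mul_eq_of_support hkl ha, hyx'] at hy
  simp only [hxk, hxl] at hy
  have h2 : a k * a l * (a l + a k) = 0 := by linear_combination hy
  have h3 := (_root_.mul_eq_zero.mp h2).resolve_left h0.ne
  exact hne (by rw [eq_neg_of_add_eq_zero_right h3, abs_neg])

theorem IsJordanFrame.frameHyperplane_mem_latticeLikeSubspaces [FiniteDimensional ℝ V]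
    {r : ℕ} {c : Fin r → V} (hc : IsJordanFrame c) {k l : Fin r} (hkl : k ≠ l) {a : Fin r → ℝ}
    (h0 : a k * a l < 0) (ha : ∀ i, i ≠ k → i ≠ l → a i = 0) :
    frameHyperplane c a ∈ latticeLikeSubspaces V := by
  refine mem_latticeLikeSubspaces fun z hz => ?_
  obtain ⟨x, hx, rfl⟩ := mem_frameHyperplane.mp hz
  refine ⟨_, mem_frameHyperplane.mpr ⟨fun i => max (x i) 0, ?_, rfl⟩,
    hc.isOrthogonalFamily.positive_part x⟩
  rw [sum_mul_eq_of_support hkl ha] at hx ⊢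
  have hal : a l ≠ 0 := right_ne_zero_of_mul h0.ne
  -- The hyperplane reads x_l = t x_k with this t > 0, and a positive factor passes through max(·,
  -- 0).
  have ht : 0 < -(a k / a l) := by
    rw [← mul_div_mul_right _ _ hal, ← neg_div]
    exact div_pos (neg_pos.mpr h0) (mul_self_pos.mpr hal)
  have hxl : x l = -(a k / a l) * x k := by
    field_simp
    linarith
  have : max (x l) 0 = -(a k / a l) * max (x k) 0 := by
    rw [hxl, mul_max_of_nonneg _ _ ht.le, mul_zero]
  rw [this]
  field_simp
  ring

end Frame

/-! ### Existence of a Jordan frame -/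

section Existence

variable {V : Type*} [NormedAddCommGroup V] [InnerProductSpace ℝ V] [EuclideanJordanAlgebra V]

/-- There is a complete family of `r` nonzero orthogonal idempotents. -/
def HasCompleteFamily (V : Type*) [NormedAddCommGroup V] [InnerProductSpace ℝ V]
    [EuclideanJordanAlgebra V] (r : ℕ) : Prop :=
  ∃ c : Fin r → V, IsOrthogonalFamily c ∧ (∀ i, c i ≠ 0) ∧ ∑ i, c i = 1

/-- Splitting one member as a + b keeps the family orthogonal: a and b annihilate each other, and by
positivity each annihilates whatever a + b annihilates. -/
theorem HasCompleteFamily.succ {r : ℕ} {c : Fin r → V} (hc : IsOrthogonalFamily c)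
    (h0 : ∀ i, c i ≠ 0) (h1 : ∑ i, c i = 1) {k : Fin r} {a b : V} (ha : a * a = a)
    (hb : b * b = b) (ha0 : a ≠ 0) (hb0 : b ≠ 0) (hk : c k = a + b) :
    HasCompleteFamily V (r + 1) := by
  have hab : a * b = 0 := mul_eq_zero_of_add ha hb (hk ▸ hc.idem k)
  have hak (j : Fin r) (hj : j ≠ k) : a * c j = 0 :=
    mul_eq_zero_of_add_mul_eq_zero ha hb (hk ▸ hc.mul_eq_zero k j hj.symm)
  have hbk (j : Fin r) (hj : j ≠ k) : b * c j = 0 :=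
    mul_eq_zero_of_add_mul_eq_zero hb ha
      (add_comm a b ▸ hk ▸ hc.mul_eq_zero k j hj.symm)
  refine ⟨Fin.cons a (Function.update c k b), ⟨?_, ?_⟩, ?_, ?_⟩
  · refine Fin.cases (by simpa) fun i => ?_
    by_cases hi : i = k
    · subst hi; simpa
    · simpa [hi] using hc.idem i
  · have hau (j : Fin r) : a * Function.update c k b j = 0 := by
      by_cases hj : j = k
      · subst hj; simpa
      · simpa [hj] using hak j hj
    refine Fin.cases (fun j => ?_) fun i j => ?_
    · refine Fin.cases (by simp) (fun j _ => ?_) j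
      simpa using hau j
    · refine Fin.cases (fun _ => ?_) (fun j hij => ?_) j
      · simpa [mul_comm _ a] using hau i
      · have hij' : i ≠ j := fun h => hij (congrArg _ h)
        by_cases hi : i = k
        · subst hi
          simpa [hij'.symm] using hbk j hij'.symm
        · by_cases hj : j = k
          · subst hj
            simpa [hi, mul_comm _ b] using hbk i hi
          · simpa [hi, hj] using hc.mul_eq_zero i j hij'
  · refine Fin.cases (by simpa) fun i => ?_
    by_cases hi : i = k
    · subst hi; simpa
    · simpa [hi] using h0 i
  · rw [Fin.sum_univ_succ]
    simp only [Fin.cons_zero, Fin.cons_succ]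
    rw [Finset.sum_update_of_mem (Finset.mem_univ k), ← add_assoc, ← hk, ← h1,
      Finset.sdiff_singleton_eq_erase, Finset.add_sum_erase _ _ (Finset.mem_univ k)]

variable [FiniteDimensional ℝ V]

/-- If 0 and 1 were the only idempotents, every spectral decomposition would be a multiple of 1 and
V would have dimension at most one. -/
theorem exists_isIdempotentElem_ne (hV : 2 ≤ Module.finrank ℝ V) :
    ∃ c : V, c * c = c ∧ c ≠ 0 ∧ c ≠ 1 := by
  by_contra! h
  have htop : Submodule.span ℝ {(1 : V)} = ⊤ := by
    refine eq_top_iff.mpr fun x _ => ?_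
    rw [← sum_spectral x]
    refine Submodule.sum_mem _ fun s _ => Submodule.smul_mem _ _ ?_
    by_cases hs : spectralIdempotent x s = 0
    · rw [hs]
      exact Submodule.zero_mem _
    · rw [h _ ((isOrthogonalFamily_spectralIdempotent x).idem s) hs]
      exact Submodule.mem_span_singleton_self _
  have := finrank_span_le_card (R := ℝ) ({(1 : V)} : Set V)
  rw [htop, finrank_top] at this
  simp at this
  omega

theorem HasCompleteFamily.le_finrank {r : ℕ} (h : HasCompleteFamily V r) :
    r ≤ Module.finrank ℝ V := by
  obtain ⟨c, hc, h0, -⟩ := h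
  simpa using (hc.linearIndependent h0).fintype_card_le_finrank

theorem hasCompleteFamily_two (hV : 2 ≤ Module.finrank ℝ V) : HasCompleteFamily V 2 := by
  obtain ⟨c, hc, h0, h1⟩ := exists_isIdempotentElem_ne hV
  have hone : (1 : V) ≠ 0 := by
    intro h
    apply h0
    rw [← EuclideanJordanAlgebra.one_mul c, h, ← mulLeft_apply, map_zero, LinearMap.zero_apply]
  refine HasCompleteFamily.succ (c := fun _ : Fin 1 => (1 : V)) (k := 0) (a := c) (b := 1 - c)
    ⟨fun _ => mul_one' 1, fun i j hij => (hij (Subsingleton.elim i j)).elim⟩ (fun _ => hone)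
    (by simp) hc ?_ h0 (sub_ne_zero.mpr h1.symm) (by abel)
  rw [← mulLeft_apply, map_sub, map_sub, LinearMap.sub_apply, LinearMap.sub_apply]
  simp only [mulLeft_apply, mul_one', EuclideanJordanAlgebra.one_mul, hc]
  abel

theorem exists_isJordanFrame (hV : 2 ≤ Module.finrank ℝ V) :
    ∃ (r : ℕ) (c : Fin r → V), 2 ≤ r ∧ IsJordanFrame c := by
  classical
  -- Linear independence bounds the size by the dimension, so a maximum exists; a non-primitive
  -- member could be split, contradicting maximality.
  set r := Nat.findGreatest (HasCompleteFamily V) (Module.finrank ℝ V)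
  have h2 := hasCompleteFamily_two hV
  obtain ⟨c, hc, h0, h1⟩ : HasCompleteFamily V r := Nat.findGreatest_spec hV h2
  refine ⟨r, c, Nat.le_findGreatest hV h2, ⟨fun i => ⟨hc.idem i, h0 i, ?_⟩, hc.mul_eq_zero, h1⟩⟩
  rintro ⟨a, b, ha, hb, ha0, hb0, hab⟩
  have hs := HasCompleteFamily.succ hc h0 h1 ha hb ha0 hb0 hab
  exact absurd (Nat.le_findGreatest hs.le_finrank hs) (Nat.not_succ_le_self r)

end Existence

end EuclideanJordanAlgebra

theorem mainTheorem7 {V : Type*} [NormedAddCommGroup V] [InnerProductSpace ℝ V]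
    [FiniteDimensional ℝ V] [EuclideanJordanAlgebra V] (hV : 2 ≤ Module.finrank ℝ V) :
    -- both inclusions hold and are strict
    EuclideanJordanAlgebra.faceSpans V ⊂ EuclideanJordanAlgebra.subalgebras V ∧
    EuclideanJordanAlgebra.subalgebras V ⊂ EuclideanJordanAlgebra.latticeLikeSubspaces V ∧
    -- there is a Jordan frame with at least two elements, so that the witnesses below exist
    (∃ (r : ℕ) (c : Fin r → V), 2 ≤ r ∧ EuclideanJordanAlgebra.IsJordanFrame c) ∧
    ∀ (r : ℕ) (c : Fin r → V), EuclideanJordanAlgebra.IsJordanFrame c →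
      ∀ k l : Fin r, k ≠ l →
        -- witnesses for the first strict inclusion
        (EuclideanJordanAlgebra.frameDiagonal c k l ∈ EuclideanJordanAlgebra.subalgebras V ∧
          EuclideanJordanAlgebra.frameDiagonal c k l ∉ EuclideanJordanAlgebra.faceSpans V) ∧
        -- witnesses for the second strict inclusion
        ∀ a : Fin r → ℝ, a k * a l < 0 → |a k| ≠ |a l| → (∀ i, i ≠ k → i ≠ l → a i = 0) →
          EuclideanJordanAlgebra.frameHyperplane c a ∈
              EuclideanJordanAlgebra.latticeLikeSubspaces V ∧
            EuclideanJordanAlgebra.frameHyperplane c a ∉ EuclideanJordanAlgebra.subalgebras V := by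
  open EuclideanJordanAlgebra in
  obtain ⟨r, c, hr, hc⟩ := exists_isJordanFrame hV
  have hkl : (⟨0, by omega⟩ : Fin r) ≠ ⟨1, by omega⟩ := by simp
  have hw : ∀ (r : ℕ) (c : Fin r → V), IsJordanFrame c → ∀ k l : Fin r, k ≠ l →
      (frameDiagonal c k l ∈ subalgebras V ∧ frameDiagonal c k l ∉ faceSpans V) ∧
        ∀ a : Fin r → ℝ, a k * a l < 0 → |a k| ≠ |a l| → (∀ i, i ≠ k → i ≠ l → a i = 0) →
          frameHyperplane c a ∈ latticeLikeSubspaces V ∧ frameHyperplane c a ∉ subalgebras V :=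
    fun r c hc k l hkl =>
      ⟨⟨hc.isOrthogonalFamily.frameDiagonal_mem_subalgebras k l,
        hc.frameDiagonal_notMem_faceSpans hkl⟩,
      fun a h0 hne ha => ⟨hc.frameHyperplane_mem_latticeLikeSubspaces hkl h0 ha,
        hc.frameHyperplane_notMem_subalgebras hkl h0 hne ha⟩⟩
  obtain ⟨⟨hd, hd'⟩, hh⟩ := hw r c hc _ _ hkl
  -- The normal (1, -2, 0, …) has entries of opposite sign and different absolute value.
  obtain ⟨hl, hl'⟩ := hh (fun i => if i = ⟨0, by omega⟩ then 1 else
    if i = ⟨1, by omega⟩ then -2 else 0) (by simp) (by norm_num) (by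
      intro i h h'
      rw [if_neg h, if_neg h'])
  exact ⟨⟨faceSpans_subset_subalgebras, fun h => hd' (h hd)⟩,
    ⟨subalgebras_subset_latticeLikeSubspaces, fun h => hl' (h hl)⟩, ⟨r, c, hr, hc⟩, hw⟩
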